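/- Let $\mathbb N^\times$ be the multiplicative monoid of positive integers, viewed as a category with a single object $*$, and let $\widehat{\mathbb N^\times}$ be the topos of contravariant functors from this category to the category of sets. A point of a topos $\mathcal T$ is a geometric morphism from the topos of sets to $\mathcal T$, i.e. an adjunction $p^*\dashv p_*$ with $p_*:\mathrm{Sets}\to\mathcal T$ and with $p^*$ preserving finite limits; a morphism of points $p\to q$ is a natural transformation $p^*\to q^*$. (i) The category of points of $\widehat{\mathbb N^\times}$ is canonically equivalent to the category whose objects are the totally ordered groups isomorphic (as ordered groups) to non-trivial subgroups of the ordered group $(\mathbb Q,\mathbb Q_+)$ and whose morphisms are the injective morphisms of ordered groups. More precisely, there is an equivalence $p\mapsto G_p$ for which the functor sending $p$ to the set $\{x\in G_p: x>0\}$, on which $n\in\mathbb N^\times$ acts by $x\mapsto nx$, is naturally isomorphic to the functor sending $p$ to the set $p^*(y(*))$ with its induced action of $\mathbb N^\times$, where $y(*)$ is the presheaf represented by $*$. (ii) Let $\mathbb A_f$ be the ring of finite adèles of $\mathbb Q$, and $\hat{\mathbb Z}\subset\mathbb A_f$ the subring of integral adèles. The set of isomorphism classes of points of $\widehat{\mathbb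 N^\times}$ is canonically in bijection with the double quotient $\mathbb Q_+^\times\backslash\mathbb A_f/\hat{\mathbb Z}^*$, where the group $\mathbb Q_+^\times$ of positive rational numbers and the group $\hat{\mathbb Z}^*$ of units of $\hat{\mathbb Z}$ act by multiplication. More precisely, with the equivalence $p\mapsto G_p$ of (i), there is a bijection under which the class of a point $p$ corresponds to the class of $a\in\mathbb A_f$ if and only if $G_p$ is isomorphic, as an ordered group, to $H_a:=\{q\in\mathbb Q\mid qa\in\hat{\mathbb Z}\}$. -/

import Mathlib

open CategoryTheory

/-! ### Geometric morphisms and points of a topos -/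

universe v₁ v₂ u₁ u₂

/-- A geometric morphism `𝓔 ⟶ 𝓕`: an adjunction `f^* ⊣ f_*` with `f_* : 𝓔 ⥤ 𝓕` and with `f^*`
preserving finite limits. -/
structure GeometricMorphism (𝓔 : Type u₁) [Category.{v₁} 𝓔] (𝓕 : Type u₂) [Category.{v₂} 𝓕] where
  /-- the direct image functor `f_*` -/
  directImage : 𝓔 ⥤ 𝓕
  /-- the inverse image functor `f^*` -/
  inverseImage : 𝓕 ⥤ 𝓔
  /-- the adjunction `f^* ⊣ f_*` -/
  adj : inverseImage ⊣ directImage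
  /-- left exactness of `f^*` -/
  preservesFiniteLimits : Limits.PreservesFiniteLimits inverseImage

/-- Morphisms `f ⟶ g` of geometric morphisms are natural transformations `f^* ⟶ g^*`. -/
instance GeometricMorphism.instCategory (𝓔 : Type u₁) [Category.{v₁} 𝓔]
    (𝓕 : Type u₂) [Category.{v₂} 𝓕] : Category (GeometricMorphism 𝓔 𝓕) where
  Hom f g := f.inverseImage ⟶ g.inverseImage
  id f := 𝟙 f.inverseImage
  comp α β := NatTrans.vcomp α β
  id_comp α := Category.id_comp (obj := 𝓕 ⥤ 𝓔) α
  comp_id α := Category.comp_id (obj := 𝓕 ⥤ 𝓔) α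
  assoc α β γ := Category.assoc (obj := 𝓕 ⥤ 𝓔) α β γ

/-- The category of points of a topos `𝓣`: geometric morphisms from the topos of sets to `𝓣`. -/
abbrev ToposPoint (𝓣 : Type u₁) [Category.{v₁} 𝓣] := GeometricMorphism Type 𝓣

/-- The presheaf topos on the category with a single object, whose endomorphism monoid is the
multiplicative monoid of positive integers. -/
abbrev NTimesTopos := (SingleObj ℕ+)ᵒᵖ ⥤ Type

/-- The functor that sends a point `p` to the set `p^*(y(*))` with its action of the positive
integers, where `y(*)` is the representable presheaf. -/
def fiberFunctor : ToposPoint NTimesTopos ⥤ (SingleObj ℕ+ ⥤ Type) where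
  obj p := yoneda ⋙ p.inverseImage
  map {p q} α := Functor.whiskerLeft yoneda (show p.inverseImage ⟶ q.inverseImage from α)
  map_id _ := rfl
  map_comp _ _ := rfl

/-! ### Totally ordered groups of rank one -/

/-- A totally ordered abelian group isomorphic, as an ordered group, to a non-trivial subgroup of
the ordered group of rational numbers. -/
structure RankOneOrderedGroup where
  /-- the underlying type -/
  carrier : Type
  [addCommGroup : AddCommGroup carrier]
  [linearOrder : LinearOrder carrier]
  [isOrderedAddMonoid : IsOrderedAddMonoid carrier]
  exists_iso : ∃ H : AddSubgroup ℚ, H ≠ ⊥ ∧ Nonempty (carrier ≃+o H)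

namespace RankOneOrderedGroup

attribute [instance] addCommGroup linearOrder isOrderedAddMonoid

/-- Morphisms are injective morphisms of ordered groups. -/
@[ext]
structure Hom (G G' : RankOneOrderedGroup) where
  /-- the underlying morphism of ordered groups -/
  hom : G.carrier →+o G'.carrier
  injective : Function.Injective hom

instance instCategory : Category RankOneOrderedGroup where
  Hom := Hom
  id G := ⟨OrderAddMonoidHom.id G.carrier, Function.injective_id⟩
  comp f g := ⟨g.hom.comp f.hom, g.injective.comp f.injective⟩

/-- The functor that sends `G` to the set of its elements `x > 0`, on which the positive
integer `n` acts by `x ↦ n • x`. -/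
def positivePart : RankOneOrderedGroup ⥤ (SingleObj ℕ+ ⥤ Type) where
  obj G :=
    { obj := fun _ => {x : G.carrier // 0 < x}
      map := fun (n : ℕ+) => ↾(fun x => ⟨(n : ℕ) • x.1, nsmul_pos x.2 n.ne_zero⟩)
      map_id := fun _ => by
        ext x
        exact one_nsmul x.1
      map_comp := fun (m n : ℕ+) => by
        ext x
        change ((n * m : ℕ+) : ℕ) • x.1 = (n : ℕ) • ((m : ℕ) • x.1)
        rw [PNat.mul_coe, mul_nsmul'] }
  map {G G'} f :=
    { app := fun _ => ↾(fun x => ⟨f.hom x.1, by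
        have h := f.hom.monotone' x.2.le
        refine lt_of_le_of_ne (by simpa using h) fun h0 => x.2.ne ?_
        exact f.injective ((map_zero f.hom).trans h0)⟩)
      naturality := fun _ _ (n : ℕ+) => by
        ext x
        exact map_nsmul f.hom (n : ℕ) x.1 }
  map_id _ := rfl
  map_comp _ _ := rfl

end RankOneOrderedGroup

/-! ### The double quotient of the finite adeles -/

/-- The ring of finite adeles of the field of rational numbers. -/
abbrev FiniteAdelesRat := IsDedekindDomain.FiniteAdeleRing ℤ ℚ

/-- The subring of integral adeles `∏ₚ ℤₚ` of the ring of finite adeles. -/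
def ZHat : Subring FiniteAdelesRat where
  carrier := {a | ∀ v, a v ∈ v.adicCompletionIntegers ℚ}
  mul_mem' ha hb v := mul_mem (ha v) (hb v)
  one_mem' v := one_mem (v.adicCompletionIntegers ℚ)
  add_mem' ha hb v := add_mem (ha v) (hb v)
  zero_mem' v := zero_mem (v.adicCompletionIntegers ℚ)
  neg_mem' ha v := neg_mem (ha v)

/-- Two finite adeles are equivalent when they differ by multiplication by a positive rational
number and by a unit of `ZHat`. -/
def adeleClassSetoid : Setoid FiniteAdelesRat where
  r a b := ∃ (q : ℚ) (u : ZHatˣ), 0 < q ∧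
    b = algebraMap ℚ FiniteAdelesRat q * a * (u : ZHat)
  iseqv :=
    { refl := fun a => ⟨1, 1, one_pos, by simp⟩
      symm := by
        rintro a b ⟨q, u, hq, rfl⟩
        refine ⟨q⁻¹, u⁻¹, inv_pos.2 hq, ?_⟩
        have h1 : algebraMap ℚ FiniteAdelesRat q⁻¹ * algebraMap ℚ FiniteAdelesRat q = 1 := by
          rw [← map_mul, inv_mul_cancel₀ hq.ne', map_one]
        have h2 : (((u : ZHat) : FiniteAdelesRat)) * ((u⁻¹ : ZHatˣ) : ZHat) = 1 := by
          rw [← Subring.coe_mul, Units.mul_inv, Subring.coe_one]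
        linear_combination (-a) * h1 - (algebraMap ℚ FiniteAdelesRat q⁻¹ *
          algebraMap ℚ FiniteAdelesRat q * a) * h2
      trans := by
        rintro a b c ⟨q, u, hq, rfl⟩ ⟨r, w, hr, rfl⟩
        refine ⟨r * q, u * w, mul_pos hr hq, ?_⟩
        rw [map_mul, Units.val_mul, Subring.coe_mul]
        ring }

/-- The double quotient of the finite adeles by the positive rational numbers and the units
of `ZHat`. -/
abbrev AdeleDoubleQuotient := Quotient adeleClassSetoid

/-- The ordered group `H_a` of the rational numbers `q` such that `q a` lies in `ZHat`. -/
def adeleSubgroup (a : FiniteAdelesRat) : AddSubgroup ℚ where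
  carrier := {q | algebraMap ℚ FiniteAdelesRat q * a ∈ ZHat}
  add_mem' {q r} hq hr := by
    have h : algebraMap ℚ FiniteAdelesRat (q + r) * a =
        algebraMap ℚ FiniteAdelesRat q * a + algebraMap ℚ FiniteAdelesRat r * a := by
      rw [map_add, add_mul]
    change algebraMap ℚ FiniteAdelesRat (q + r) * a ∈ ZHat
    rw [h]
    exact add_mem hq hr
  zero_mem' := by
    have h : algebraMap ℚ FiniteAdelesRat 0 * a = 0 := by rw [map_zero, zero_mul]
    change algebraMap ℚ FiniteAdelesRat 0 * a ∈ ZHat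
    rw [h]
    exact zero_mem ZHat
  neg_mem' {q} hq := by
    have h : algebraMap ℚ FiniteAdelesRat (-q) * a = -(algebraMap ℚ FiniteAdelesRat q * a) := by
      rw [map_neg, neg_mul]
    change algebraMap ℚ FiniteAdelesRat (-q) * a ∈ ZHat
    rw [h]
    exact neg_mem hq

/-! Every presheaf is a colimit of representables and `p^*` is cocontinuous, so a point is
determined by the action of `ℕ+` on `p^*(y(*))`: `fiberFunctor` is fully faithful. The actions that
arise are the flat ones: nonempty, free, and such that any two elements are multiples of a third.
The positive part of a rank one group is flat by Bézout. Conversely, a flat action embeds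
equivariantly in the positive rationals, and its image is the positive part of the subgroup it
generates. As `positivePart` is fully faithful too, two fully faithful functors with the same
essential image give the equivalence.

For the adeles, isomorphisms between subgroups of `ℚ` are multiplications by positive rationals. The
subgroup `H_a` records exactly the absolute values of the components of `a`, that is, `a` up to
units of `ZHat` (`valued_le_of_adeleSubgroup_le`, `exists_ZHat_unit`). Every subgroup containing `1`
is some `H_a`, since it is determined by the inverse prime powers it contains
(`exists_adeleSubgroup_eq`). -/

/-! ### Points of a presheaf topos and their values on representables -/

section PresheafTopos

open Limits Opposite

variable {C : Type} [SmallCategory C]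

/-- Elements of the value of a cocontinuous functor at a presheaf come from representables. -/
theorem exists_map_yoneda_eq (F : (Cᵒᵖ ⥤ Type) ⥤ Type) [PreservesColimitsOfSize.{0, 0} F]
    (P : Cᵒᵖ ⥤ Type) (t : F.obj P) :
    ∃ (c : C) (s : yoneda.obj c ⟶ P) (x : F.obj (yoneda.obj c)), F.map s x = t := by
  obtain ⟨j, x, h⟩ := Types.jointly_surjective_of_isColimit
    (isColimitOfPreserves F (Presheaf.isColimitTautologicalCocone P)) t
  exact ⟨j.left, j.hom, x, h⟩

theorem natTrans_ext_of_yoneda {F G : (Cᵒᵖ ⥤ Type) ⥤ Type} [PreservesColimitsOfSize.{0, 0} F]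
    {α β : F ⟶ G} (h : Functor.whiskerLeft yoneda α = Functor.whiskerLeft yoneda β) : α = β := by
  ext P t
  obtain ⟨c, s, x, rfl⟩ := exists_map_yoneda_eq F P t
  have hc : α.app (yoneda.obj c) = β.app (yoneda.obj c) := congr_app h c
  have h1 := congrArg (fun g => g x) (α.naturality s)
  have h2 := congrArg (fun g => g x) (β.naturality s)
  exact h1.trans ((congrArg (fun g => G.map s (g x)) hc).trans h2.symm)

/-- `F` carries the tautological colimit of representables over `P` to a colimit, so `τ` induces a
map out of `F.obj P`; naturality is tested on the legs. -/
theorem exists_natTrans_of_yoneda {F G : (Cᵒᵖ ⥤ Type) ⥤ Type} [PreservesColimitsOfSize.{0, 0} F]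
    (τ : yoneda ⋙ F ⟶ yoneda ⋙ G) : ∃ α : F ⟶ G, Functor.whiskerLeft yoneda α = τ := by
  have key (P : Cᵒᵖ ⥤ Type) : ∃ a : F.obj P ⟶ G.obj P,
      ∀ {d : C} (s : yoneda.obj d ⟶ P), F.map s ≫ a = τ.app d ≫ G.map s := by
    let c : Cocone ((CostructuredArrow.proj yoneda P ⋙ yoneda) ⋙ F) :=
      { pt := G.obj P
        ι := { app := fun j => τ.app j.left ≫ G.map j.hom
               naturality := fun i j f => by
                have h1 : F.map (yoneda.map f.left) ≫ τ.app j.left =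
                  τ.app i.left ≫ G.map (yoneda.map f.left) := τ.naturality f.left
                have h2 : G.map (yoneda.map f.left) ≫ G.map j.hom = G.map i.hom := by
                  rw [← G.map_comp]
                  exact congrArg G.map (CostructuredArrow.w f)
                change F.map (yoneda.map f.left) ≫ τ.app j.left ≫ G.map j.hom =
                  (τ.app i.left ≫ G.map i.hom) ≫ 𝟙 (G.obj P)
                rw [reassoc_of% h1, h2, Category.comp_id] } }
    exact ⟨(isColimitOfPreserves F (Presheaf.isColimitTautologicalCocone P)).desc c,
      fun s => (isColimitOfPreserves F (Presheaf.isColimitTautologicalCocone P)).fac c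
        (CostructuredArrow.mk s)⟩
  choose a ha using key
  refine ⟨{ app := a, naturality := fun P Q f => ?_ }, ?_⟩
  · refine (isColimitOfPreserves F (Presheaf.isColimitTautologicalCocone P)).hom_ext fun j => ?_
    change F.map j.hom ≫ F.map f ≫ a Q = F.map j.hom ≫ a P ≫ G.map f
    rw [← Category.assoc, ← F.map_comp, ha, ← Category.assoc, ha, G.map_comp, Category.assoc]
  · ext d : 2
    have h := ha (yoneda.obj d) (𝟙 _)
    rw [F.map_id, G.map_id, Category.id_comp, Category.comp_id] at h
    exact h

/-- Filtered colimits along the elements of a flat functor give a point of the presheaf topos. -/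
theorem exists_toposPoint (X : C ⥤ Type) [IsCofiltered X.Elements] :
    ∃ p : ToposPoint (Cᵒᵖ ⥤ Type), Nonempty (yoneda ⋙ p.inverseImage ≅ X) := by
  -- For the trivial topology only maximal sieves cover, so a point of the site is just a functor
  -- with cofiltered category of elements.
  let Φ : GrothendieckTopology.Point.{0} (⊥ : GrothendieckTopology C) :=
    { fiber := X
      initiallySmall := initiallySmall_of_essentiallySmall _
      jointly_surjective := fun {U} R hR x => by
        obtain rfl : R = ⊤ := by simpa using hR
        exact ⟨U, 𝟙 _, trivial, x, by simp⟩ }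
  exact ⟨⟨Φ.skyscraperPresheafFunctor, Φ.presheafFiber, Φ.skyscraperPresheafAdjunction,
    inferInstance⟩, ⟨Functor.isoWhiskerRight shrinkYonedaIsoYoneda.symm _ ≪≫
      Φ.shrinkYonedaCompPresheafFiberIso⟩⟩

end PresheafTopos

instance ToposPoint.preservesColimits {𝓣 : Type*} [Category 𝓣] (p : ToposPoint 𝓣) :
    Limits.PreservesColimitsOfSize.{0, 0} p.inverseImage :=
  p.adj.leftAdjoint_preservesColimits

instance : fiberFunctor.Faithful where
  map_injective {_ _} _ _ h := natTrans_ext_of_yoneda h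

instance : fiberFunctor.Full where
  map_surjective {_ _} τ := exists_natTrans_of_yoneda τ

/-! ### Flat actions of the positive integers -/

namespace PNatAction

/-- The action of a positive integer on the set underlying a functor on `SingleObj ℕ+`. -/
def act (X : SingleObj ℕ+ ⥤ Type) (n : ℕ+) (x : X.obj (SingleObj.star ℕ+)) :
    X.obj (SingleObj.star ℕ+) :=
  X.map (X := SingleObj.star ℕ+) (Y := SingleObj.star ℕ+) n x

theorem act_mul (X : SingleObj ℕ+ ⥤ Type) (n m : ℕ+) (x : X.obj (SingleObj.star ℕ+)) :
    act X (n * m) x = act X n (act X m x) :=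
  congrArg (fun f => f x) (X.map_comp (X := SingleObj.star ℕ+) (Y := SingleObj.star ℕ+)
    (Z := SingleObj.star ℕ+) m n)

theorem naturality {X Y : SingleObj ℕ+ ⥤ Type} (f : X ⟶ Y) (n : ℕ+)
    (x : X.obj (SingleObj.star ℕ+)) :
    f.app (SingleObj.star ℕ+) (act X n x) = act Y n (f.app (SingleObj.star ℕ+) x) :=
  congrArg (fun g => g x) (f.naturality (X := SingleObj.star ℕ+) (Y := SingleObj.star ℕ+) n)

/-- Equivariant maps are natural transformations. -/
def homMk {X Y : SingleObj ℕ+ ⥤ Type}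
    (f : X.obj (SingleObj.star ℕ+) → Y.obj (SingleObj.star ℕ+))
    (hf : ∀ n x, f (act X n x) = act Y n (f x)) : X ⟶ Y where
  app _ := ↾f
  naturality _ _ n := by
    ext x
    exact hf n x

/-- Flat actions of the positive integers: the category of elements is cofiltered. -/
structure IsFlat (X : SingleObj ℕ+ ⥤ Type) : Prop where
  nonempty : Nonempty (X.obj (SingleObj.star ℕ+))
  free : ∀ n m x, act X n x = act X m x → n = m
  directed : ∀ x y, ∃ z n m, act X n z = x ∧ act X m z = y

theorem IsFlat.of_iso {X Y : SingleObj ℕ+ ⥤ Type} (e : X ≅ Y) (hX : IsFlat X) : IsFlat Y where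
  nonempty := hX.nonempty.map (e.hom.app _)
  free n m y h := hX.free n m (e.inv.app _ y) (by rw [← naturality, h, naturality])
  directed x y := by
    obtain ⟨z, n, m, h1, h2⟩ := hX.directed (e.inv.app _ x) (e.inv.app _ y)
    refine ⟨e.hom.app _ z, n, m, ?_, ?_⟩
    · rw [← naturality, h1]; simp
    · rw [← naturality, h2]; simp

theorem IsFlat.isCofiltered {X : SingleObj ℕ+ ⥤ Type} (hX : IsFlat X) :
    IsCofiltered X.Elements where
  nonempty := hX.nonempty.map fun x => ⟨_, x⟩
  cone_objs := fun ⟨_, x⟩ ⟨_, y⟩ => by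
    obtain ⟨z, n, m, h1, h2⟩ := hX.directed x y
    exact ⟨⟨_, z⟩, ⟨n, h1⟩, ⟨m, h2⟩, trivial⟩
  cone_maps := fun ⟨_, x⟩ ⟨_, y⟩ f g => by
    have h : f = g := Subtype.ext (hX.free f.1 g.1 x (f.2.trans g.2.symm))
    exact ⟨_, 𝟙 _, by rw [h]⟩

/-- The three conditions come from preservation of the terminal object, of equalizers and of binary
products, since elements of the fibre at such a limit come from representables. -/
theorem isFlat_fiberFunctor (p : ToposPoint NTimesTopos) : IsFlat (fiberFunctor.obj p) := by
  have := p.preservesFiniteLimits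
  let y := yoneda.obj (SingleObj.star ℕ+)
  refine ⟨?_, fun n m x h => ?_, fun x x' => ?_⟩
  · have hT := Limits.IsTerminal.isTerminalObj p.inverseImage _
      (Limits.terminalIsTerminal (C := NTimesTopos))
    obtain ⟨c, s, x, -⟩ := exists_map_yoneda_eq p.inverseImage _
      (hT.from PUnit PUnit.unit)
    exact ⟨x⟩
  · let f : y ⟶ y := yoneda.map (X := SingleObj.star ℕ+) (Y := SingleObj.star ℕ+) n
    let g : y ⟶ y := yoneda.map (X := SingleObj.star ℕ+) (Y := SingleObj.star ℕ+) m
    have hE := Limits.isLimitOfHasEqualizerOfPreservesLimit p.inverseImage f g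
    have hx : (↾fun _ : PUnit => x) ≫ p.inverseImage.map f =
        (↾fun _ : PUnit => x) ≫ p.inverseImage.map g := by
      ext
      exact h
    -- A point in the fibre of the equalizer of `n` and `m` forces a map from a representable into
    -- it, that is, some `k` with `n * k = m * k`.
    obtain ⟨c, s, -, -⟩ := exists_map_yoneda_eq p.inverseImage _
      (Limits.Fork.IsLimit.lift hE (↾fun _ : PUnit => x) hx PUnit.unit)
    obtain ⟨k, hk⟩ := yoneda.map_surjective (X := c) (Y := SingleObj.star ℕ+)
      (s ≫ Limits.equalizer.ι f g)
    have hs : s ≫ Limits.equalizer.ι f g ≫ f = s ≫ Limits.equalizer.ι f g ≫ g := by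
      rw [Limits.equalizer.condition]
    rw [← Category.assoc, ← Category.assoc, ← hk, ← yoneda.map_comp, ← yoneda.map_comp] at hs
    exact mul_right_cancel (G := ℕ+) (b := k) (yoneda.map_injective hs)
  · have hP := Limits.isLimitOfHasBinaryProductOfPreservesLimit p.inverseImage y y
    obtain ⟨l, hl1, hl2⟩ := Limits.BinaryFan.IsLimit.lift' hP (↾fun _ : PUnit => x)
      (↾fun _ : PUnit => x')
    obtain ⟨c, s, z, hz⟩ := exists_map_yoneda_eq p.inverseImage _ (l PUnit.unit)
    have key (π : Limits.prod y y ⟶ y) : ∃ n, act (fiberFunctor.obj p) n z =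
        p.inverseImage.map π (l PUnit.unit) := by
      obtain ⟨n, hn⟩ := yoneda.map_surjective (X := c) (Y := SingleObj.star ℕ+) (s ≫ π)
      refine ⟨n, ?_⟩
      rw [← hz]
      change p.inverseImage.map (yoneda.map n) z = _
      rw [hn, p.inverseImage.map_comp]
      rfl
    obtain ⟨n, hn⟩ := key Limits.prod.fst
    obtain ⟨m, hm⟩ := key Limits.prod.snd
    exact ⟨z, n, m, hn.trans (congrArg (fun g => g PUnit.unit) hl1),
      hm.trans (congrArg (fun g => g PUnit.unit) hl2)⟩

end PNatAction

/-! ### Comparison of fully faithful functors -/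

namespace CategoryTheory.Functor

/-- Two fully faithful functors with the same essential image have equivalent sources. -/
theorem exists_equivalence_comp_iso {A B C : Type*} [Category A] [Category B] [Category C]
    (F : A ⥤ C) (P : B ⥤ C) [F.Full] [F.Faithful] [P.Full] [P.Faithful]
    (hF : ∀ a, ∃ b, Nonempty (P.obj b ≅ F.obj a)) (hP : ∀ b, ∃ a, Nonempty (F.obj a ≅ P.obj b)) :
    ∃ E : A ≌ B, Nonempty (E.functor ⋙ P ≅ F) := by
  choose o i using hF
  let i' a := (i a).some
  let E : A ⥤ B :=
    { obj := o
      map := fun {a a'} f => P.preimage ((i' a).hom ≫ F.map f ≫ (i' a').inv)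
      map_id := fun a => P.map_injective (by simp)
      map_comp := fun f g => P.map_injective (by simp) }
  have hE : E ⋙ P ≅ F := NatIso.ofComponents i' fun f => by simp [E]
  have : (E ⋙ P).Full := Full.of_iso hE.symm
  have : (E ⋙ P).Faithful := Faithful.of_iso hE.symm
  have : E.Full := Full.of_comp_faithful E P
  have : E.Faithful := Faithful.of_comp E P
  have : E.EssSurj := ⟨fun b => by
    obtain ⟨a, ⟨j⟩⟩ := hP b
    exact ⟨a, ⟨P.preimageIso (i' a ≪≫ j)⟩⟩⟩
  have : E.IsEquivalence := {}
  exact ⟨E.asEquivalence, ⟨hE⟩⟩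

end CategoryTheory.Functor

/-! ### Positive parts of rank one ordered groups -/

namespace RankOneOrderedGroup

open PNatAction

/-- A non-trivial subgroup of the rational numbers. -/
def ofSubgroup (H : AddSubgroup ℚ) (hH : H ≠ ⊥) : RankOneOrderedGroup where
  carrier := H
  exists_iso := ⟨H, hH, ⟨OrderAddMonoidIso.refl H⟩⟩

theorem exists_pos (G : RankOneOrderedGroup) : ∃ x : G.carrier, 0 < x := by
  obtain ⟨H, hH, ⟨e⟩⟩ := G.exists_iso
  obtain ⟨q, hq, h0⟩ := H.bot_or_exists_ne_zero.resolve_left hH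
  refine ⟨|e.symm ⟨q, hq⟩|, abs_pos.2 fun h => h0 ?_⟩
  rw [EmbeddingLike.map_eq_zero_iff] at h
  exact congrArg Subtype.val h

/-- Two positive elements are positive multiples of a third one. -/
theorem exists_common_divisor (G : RankOneOrderedGroup) {x y : G.carrier} (hx : 0 < x)
    (hy : 0 < y) : ∃ z, 0 < z ∧ ∃ n m : ℕ+, (n : ℕ) • z = x ∧ (m : ℕ) • z = y := by
  obtain ⟨H, -, ⟨e⟩⟩ := G.exists_iso
  have hq : (0 : ℚ) < (e x : ℚ) := by
    have := e.strictMono hx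
    rw [map_zero] at this
    exact this
  have hr : (0 : ℚ) < (e y : ℚ) := by
    have := e.strictMono hy
    rw [map_zero] at this
    exact this
  obtain ⟨t, ht⟩ : ∃ t : ℚ, (e x : ℚ) / e y = t := ⟨_, rfl⟩
  have ht0 : 0 < t := ht ▸ div_pos hq hr
  have hnum : 0 < t.num := Rat.num_pos.2 ht0
  have hrel : (t.den : ℤ) • x = t.num • y := by
    refine EquivLike.injective e ?_
    apply Subtype.ext
    rw [map_zsmul, map_zsmul, AddSubgroup.coe_zsmul, AddSubgroup.coe_zsmul, zsmul_eq_mul,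
      zsmul_eq_mul]
    have h1 : (e x : ℚ) = t * e y := by rw [← ht, div_mul_cancel₀ _ hr.ne']
    have h2 : t * t.den = t.num := Rat.mul_den_eq_num t
    rw [h1]
    push_cast
    linear_combination (e y : ℚ) * h2
  have hcop : IsCoprime t.num (t.den : ℤ) := by
    rw [Int.isCoprime_iff_gcd_eq_one, Int.gcd, Int.natAbs_natCast]
    exact t.reduced
  obtain ⟨u, w, huw⟩ := hcop
  -- The greatest common divisor of `x` and `y`: if `x / y = a / b` in lowest terms and `u a + w b =
  -- 1`, then `a z = x` and `b z = y`.
  let z := u • x + w • y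
  have h1 : t.num • z = x := by
    calc t.num • z = (u * t.num) • x + w • (t.num • y) := by
          simp only [z, smul_add, ← mul_smul, mul_comm]
      _ = x := by rw [← hrel, ← mul_smul, ← add_smul, huw, one_smul]
  have h2 : (t.den : ℤ) • z = y := by
    calc (t.den : ℤ) • z = u • ((t.den : ℤ) • x) + (w * t.den) • y := by
          simp only [z, smul_add, ← mul_smul, mul_comm]
      _ = y := by rw [hrel, ← mul_smul, ← add_smul, huw, one_smul]
  have hz : 0 < z := by
    by_contra h
    have h3 := zsmul_nonneg (neg_nonneg.2 (not_lt.1 h)) hnum.le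
    rw [smul_neg, h1] at h3
    exact hx.not_ge (neg_nonneg.1 h3)
  refine ⟨z, hz, ⟨t.num.toNat, by omega⟩, ⟨t.den, t.den_pos⟩, ?_, ?_⟩
  · rw [← natCast_zsmul, PNat.mk_coe, Int.toNat_of_nonneg hnum.le, h1]
  · rw [← natCast_zsmul, PNat.mk_coe, h2]

theorem isFlat_positivePart (G : RankOneOrderedGroup) : IsFlat (positivePart.obj G) where
  nonempty := let ⟨x, hx⟩ := G.exists_pos; ⟨⟨x, hx⟩⟩
  free n m x h := by
    have h' : (n : ℕ) • x.1 = (m : ℕ) • x.1 := congrArg Subtype.val h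
    exact PNat.coe_injective (nsmul_left_strictMono x.2 |>.injective h')
  directed := fun ⟨x, hx⟩ ⟨y, hy⟩ => by
    obtain ⟨z, hz, n, m, h1, h2⟩ := G.exists_common_divisor hx hy
    exact ⟨⟨z, hz⟩, n, m, Subtype.ext h1, Subtype.ext h2⟩

instance : positivePart.Faithful where
  map_injective {G G'} f g h := by
    have key (x : G.carrier) (hx : 0 < x) : f.hom x = g.hom x :=
      congrArg (fun t => (t.app (SingleObj.star ℕ+) ⟨x, hx⟩).1) h
    refine Hom.ext (DFunLike.ext _ _ fun x => ?_)
    rcases lt_trichotomy x 0 with hx | rfl | hx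
    · have := key (-x) (neg_pos.2 hx)
      rwa [map_neg, map_neg, neg_inj] at this
    · rw [map_zero, map_zero]
    · exact key x hx

instance : positivePart.Full where
  map_surjective {G G'} τ := by
    obtain ⟨x₀, hx₀⟩ := G.exists_pos
    let φ (x : G.carrier) (hx : 0 < x) : G'.carrier := (τ.app (SingleObj.star ℕ+) ⟨x, hx⟩).1
    have φ_pos x hx : 0 < φ x hx := (τ.app (SingleObj.star ℕ+) ⟨x, hx⟩).2
    have φ_nsmul (n : ℕ+) x hx hnx : φ ((n : ℕ) • x) hnx = (n : ℕ) • φ x hx :=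
      congrArg Subtype.val (naturality τ n ⟨x, hx⟩)
    -- Equivariance alone gives additivity, because `x` and `y` are multiples of a common `z`.
    have φ_add x y hx hy hxy : φ (x + y) hxy = φ x hx + φ y hy := by
      obtain ⟨z, hz, n, m, rfl, rfl⟩ := G.exists_common_divisor hx hy
      have h := φ_nsmul (n + m) z hz (nsmul_pos hz (n + m).ne_zero)
      simp only [PNat.add_coe, add_nsmul] at h
      rw [φ_nsmul n z hz, φ_nsmul m z hz, h]
    have hq (x : G.carrier) : 0 < |x| + x₀ := add_pos_of_nonneg_of_pos (abs_nonneg x) hx₀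
    have hp (x : G.carrier) : 0 < |x| + x₀ + x := by
      have := neg_abs_le x
      rw [add_right_comm]
      exact add_pos_of_nonneg_of_pos (neg_le_iff_add_nonneg'.1 this) hx₀
    have φ_congr x y hx hy (h : x = y) : φ x hx = φ y hy := by subst h; rfl
    -- Any `x` is the difference of `|x| + x₀ + x` and `|x| + x₀`; the term `x₀` makes both strictly
    -- positive.
    let f : G.carrier → G'.carrier := fun x => φ _ (hp x) - φ _ (hq x)
    have f_pos x (hx : 0 < x) : f x = φ x hx := by
      simp only [f]
      rw [φ_add _ _ (hq x) hx, add_sub_cancel_left]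
    have f_add x y : f (x + y) = f x + f y := by
      have h := φ_congr (|x + y| + x₀ + (x + y) + (|x| + x₀ + (|y| + x₀)))
        (|x + y| + x₀ + (|x| + x₀ + x + (|y| + x₀ + y)))
        (add_pos (hp _) (add_pos (hq x) (hq y))) (add_pos (hq _) (add_pos (hp x) (hp y)))
        (by abel)
      rw [φ_add _ _ (hp _) (add_pos (hq x) (hq y)), φ_add _ _ (hq _) (add_pos (hp x) (hp y)),
        φ_add _ _ (hq x) (hq y), φ_add _ _ (hp x) (hp y)] at h
      simp only [f]
      rw [sub_add_sub_comm, sub_eq_sub_iff_add_eq_add, h, add_comm]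
    let f' : G.carrier →+ G'.carrier := AddMonoidHom.mk' f f_add
    have f'_pos x (hx : 0 < x) : 0 < f' x := (φ_pos x hx).trans_eq (f_pos x hx).symm
    refine ⟨⟨{ f' with
      monotone' := (monotone_iff_map_nonneg f').2 fun x hx => ?_ }, ?_⟩, ?_⟩
    · rcases hx.eq_or_lt with rfl | hx
      · rw [map_zero]
      · exact (f'_pos x hx).le
    · refine (injective_iff_map_eq_zero f').2 fun x hx => ?_
      rcases lt_trichotomy x 0 with h | h | h
      · have := f'_pos (-x) (neg_pos.2 h)
        rw [map_neg, hx, neg_zero] at this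
        exact absurd this (lt_irrefl 0)
      · exact h
      · exact absurd hx (f'_pos x h).ne'
    · ext a x
      exact Subtype.ext (f_pos x.1 x.2)

end RankOneOrderedGroup

/-! ### Realization of flat actions inside the rationals -/

namespace PNatAction

/-- The value `φ x` is the ratio `x / x₀` for a fixed base element: if `x = a z` and `x₀ = b z`, it
is `a / b`. A common divisor of two such `z` and freeness turn equalities of elements into
equalities of integers, whence equivariance. -/
theorem exists_equivariant_rat {X : SingleObj ℕ+ ⥤ Type} (hX : IsFlat X) :
    ∃ φ : X.obj (SingleObj.star ℕ+) → ℚ, (∀ x, 0 < φ x) ∧ ∀ n x, φ (act X n x) = n * φ x := by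
  obtain ⟨x₀⟩ := hX.nonempty
  choose z a b ha hb using fun x => hX.directed x x₀
  refine ⟨fun x => a x / b x, fun x => by have := (a x).pos; have := (b x).pos; positivity,
    fun n x => ?_⟩
  obtain ⟨w, c, d, hc, hd⟩ := hX.directed (z x) (z (act X n x))
  have h1 : n * a x * c = a (act X n x) * d := hX.free _ _ w (by
    rw [act_mul, act_mul, act_mul, hc, hd, ha, ha])
  have h2 : b x * c = b (act X n x) * d := hX.free _ _ w (by
    rw [act_mul, act_mul, hc, hd, hb, hb])
  have h1' : (n * a x * c : ℚ) = a (act X n x) * d := mod_cast congrArg PNat.val h1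
  have h2' : (b x * c : ℚ) = b (act X n x) * d := mod_cast congrArg PNat.val h2
  have hc0 : (c : ℚ) ≠ 0 := by simp
  have hd0 : (d : ℚ) ≠ 0 := by simp
  have hb0 : (b x : ℚ) ≠ 0 := by simp
  have hb1 : (b (act X n x) : ℚ) ≠ 0 := by simp
  rw [← mul_div_assoc, div_eq_div_iff hb1 hb0]
  apply mul_right_cancel₀ (mul_ne_zero hc0 hd0)
  linear_combination (a (act X n x) * d : ℚ) * h2' - (b (act X n x) * d : ℚ) * h1'

/-- A flat action is the positive cone of a rank one ordered group. -/
theorem IsFlat.exists_positivePart_iso {X : SingleObj ℕ+ ⥤ Type} (hX : IsFlat X) :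
    ∃ G, Nonempty (RankOneOrderedGroup.positivePart.obj G ≅ X) := by
  obtain ⟨φ, hpos, hφ⟩ := exists_equivariant_rat hX
  -- Integer multiples of single values already form a group, as two values are always multiples of
  -- a third.
  let H : AddSubgroup ℚ :=
    { carrier := {q | ∃ (x : _) (k : ℤ), q = k * φ x}
      zero_mem' := let ⟨x⟩ := hX.nonempty; ⟨x, 0, by simp⟩
      neg_mem' := by
        rintro _ ⟨x, k, rfl⟩
        exact ⟨x, -k, by simp⟩
      add_mem' := by
        rintro _ _ ⟨x, k, rfl⟩ ⟨y, l, rfl⟩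
        obtain ⟨w, n, m, rfl, rfl⟩ := hX.directed x y
        refine ⟨w, k * n + l * m, ?_⟩
        rw [hφ, hφ]
        push_cast
        ring }
  have hmem x : φ x ∈ H := ⟨x, 1, by simp⟩
  have hH : H ≠ ⊥ := fun h => by
    obtain ⟨x⟩ := hX.nonempty
    have := hmem x
    rw [h, AddSubgroup.mem_bot] at this
    exact (hpos x).ne' this
  let f (x : X.obj (SingleObj.star ℕ+)) :
      (RankOneOrderedGroup.positivePart.obj (.ofSubgroup H hH)).obj (SingleObj.star ℕ+) :=
    ⟨(⟨φ x, hmem x⟩ : H), hpos x⟩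
  have hf : Function.Bijective f := by
    constructor
    · intro x y hxy
      have h : φ x = φ y := congrArg (fun t : {t : H // 0 < t} => (t.1 : ℚ)) hxy
      obtain ⟨w, n, m, rfl, rfl⟩ := hX.directed x y
      rw [hφ, hφ] at h
      have h' := mul_right_cancel₀ (hpos w).ne' h
      rw [PNat.coe_injective (Nat.cast_injective (R := ℚ) h')]
    · rintro ⟨⟨q, x, k, rfl⟩, hq⟩
      have hk : 0 < k := by
        have : (0 : ℚ) < k * φ x := hq
        exact_mod_cast pos_of_mul_pos_left this (hpos x).le
      lift k to ℕ using hk.le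
      exact ⟨act X ⟨k, Nat.cast_pos.1 hk⟩ x, Subtype.ext (Subtype.ext (hφ _ x))⟩
  let F : X ⟶ RankOneOrderedGroup.positivePart.obj (.ofSubgroup H hH) :=
    homMk f fun n x => Subtype.ext (Subtype.ext ((hφ n x).trans (nsmul_eq_mul _ _).symm))
  have : IsIso F := by
    rw [NatTrans.isIso_iff_isIso_app]
    intro c
    exact (isIso_iff_bijective (F.app c)).2 hf
  exact ⟨_, ⟨(asIso F).symm⟩⟩

end PNatAction

theorem exists_toposPoint_equivalence :
    ∃ E : ToposPoint NTimesTopos ≌ RankOneOrderedGroup,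
      Nonempty (E.functor ⋙ RankOneOrderedGroup.positivePart ≅ fiberFunctor) := by
  refine Functor.exists_equivalence_comp_iso _ _
    (fun p => (PNatAction.isFlat_fiberFunctor p).exists_positivePart_iso) fun G => ?_
  have := (RankOneOrderedGroup.isFlat_positivePart G).isCofiltered
  exact exists_toposPoint (RankOneOrderedGroup.positivePart.obj G)

/-! ### Subgroups of the rationals -/

section SubgroupsOfRat

/-- An isomorphism of ordered groups between subgroups of `ℚ` is a multiplication by a positive
rational number. -/
theorem AddSubgroup.nonempty_orderIso_iff_exists_mul {H K : AddSubgroup ℚ} (hH : H ≠ ⊥) :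
    Nonempty (H ≃+o K) ↔ ∃ c : ℚ, 0 < c ∧ ∀ q, q ∈ H ↔ c * q ∈ K := by
  constructor
  · rintro ⟨e⟩
    obtain ⟨x, hx⟩ := RankOneOrderedGroup.exists_pos (.ofSubgroup H hH)
    change H at x
    have hx' : (0 : ℚ) < x := hx
    have hex : (0 : ℚ) < e x := by
      have := e.strictMono (show (0 : H) < x from hx)
      rw [map_zero] at this
      exact this
    have key (y : H) : (e y : ℚ) = e x / x * y := by
      -- Two rationals are commensurable, so additivity of `e` makes `e y / y` constant; both sides
      -- equal the product of the numerators.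
      have h1 : ((y : ℚ).num * (x : ℚ).den : ℤ) • x = ((x : ℚ).num * (y : ℚ).den : ℤ) • y := by
        apply Subtype.ext
        rw [AddSubgroup.coe_zsmul, AddSubgroup.coe_zsmul, zsmul_eq_mul, zsmul_eq_mul]
        push_cast
        linear_combination (x : ℚ) * (x : ℚ).den * (-(y : ℚ).mul_den_eq_num) +
          (y : ℚ) * (y : ℚ).den * ((x : ℚ).mul_den_eq_num)
      have h2 := congrArg (fun t => (e t : ℚ)) h1
      simp only [map_zsmul, AddSubgroup.coe_zsmul, zsmul_eq_mul] at h2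
      push_cast at h2
      have hxd : ((x : ℚ).den : ℚ) ≠ 0 := by simp
      have hyd : ((y : ℚ).den : ℚ) ≠ 0 := by simp
      rw [div_mul_eq_mul_div, eq_div_iff hx'.ne']
      apply mul_right_cancel₀ (mul_ne_zero hxd hyd)
      linear_combination (-h2) + (e y : ℚ) * (y : ℚ).den * ((x : ℚ).mul_den_eq_num) -
        (e x : ℚ) * (x : ℚ).den * ((y : ℚ).mul_den_eq_num)
    refine ⟨e x / x, div_pos hex hx', fun q => ⟨fun hq => ?_, fun hq => ?_⟩⟩
    · rw [← key ⟨q, hq⟩]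
      exact SetLike.coe_mem _
    · obtain ⟨y, hy⟩ := EquivLike.surjective e ⟨_, hq⟩
      have h := (key y).symm.trans (congrArg Subtype.val hy)
      rw [← mul_left_cancel₀ (div_pos hex hx').ne' h]
      exact y.2
  · rintro ⟨c, hc, h⟩
    exact ⟨{
      toFun := fun q => ⟨c * q, (h q).1 q.2⟩
      invFun := fun r => ⟨c⁻¹ * r, (h _).2 (by rw [mul_inv_cancel_left₀ hc.ne']; exact r.2)⟩
      left_inv := fun q => Subtype.ext (inv_mul_cancel_left₀ hc.ne' _)
      right_inv := fun r => Subtype.ext (mul_inv_cancel_left₀ hc.ne' _)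
      map_add' := fun q r => Subtype.ext (mul_add c q r)
      map_le_map_iff' := fun {q r} => mul_le_mul_iff_right₀ hc }⟩

/-- A non-trivial subgroup of `ℚ` is isomorphic to one that contains `1`. -/
theorem AddSubgroup.exists_orderIso_one_mem {H : AddSubgroup ℚ} (hH : H ≠ ⊥) :
    ∃ K : AddSubgroup ℚ, 1 ∈ K ∧ Nonempty (H ≃+o K) := by
  obtain ⟨⟨x, hxH⟩, hx⟩ := RankOneOrderedGroup.exists_pos (.ofSubgroup H hH)
  have hx' : 0 < x := hx
  refine ⟨H.comap (AddMonoidHom.mulLeft x), ?_, (nonempty_orderIso_iff_exists_mul hH).2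
    ⟨x⁻¹, inv_pos.2 hx', fun q => ?_⟩⟩
  · simpa using hxH
  · simp [mul_inv_cancel_left₀ hx'.ne']

theorem AddSubgroup.intCast_mul_mem {H : AddSubgroup ℚ} {q : ℚ} (hq : q ∈ H) (n : ℤ) :
    n * q ∈ H := by
  rw [← zsmul_eq_mul]
  exact H.zsmul_mem hq n

theorem AddSubgroup.inv_mul_mem_of_coprime {H : AddSubgroup ℚ} {m n : ℕ} (h : m.Coprime n)
    (hm0 : m ≠ 0) (hn0 : n ≠ 0) (hm : (m : ℚ)⁻¹ ∈ H) (hn : (n : ℚ)⁻¹ ∈ H) :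
    ((m * n : ℕ) : ℚ)⁻¹ ∈ H := by
  obtain ⟨u, w, huw⟩ := Nat.isCoprime_iff_coprime.2 h
  have huw' : (u * m + w * n : ℚ) = 1 := mod_cast huw
  have hm0' : (m : ℚ) ≠ 0 := mod_cast hm0
  have hn0' : (n : ℚ) ≠ 0 := mod_cast hn0
  have : ((m * n : ℕ) : ℚ)⁻¹ = u * (n : ℚ)⁻¹ + w * (m : ℚ)⁻¹ := by
    push_cast
    field_simp
    linear_combination -huw'
  rw [this]
  exact H.add_mem (intCast_mul_mem hn u) (intCast_mul_mem hm w)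

theorem AddSubgroup.inv_natCast_mem_of_prime_pow {H : AddSubgroup ℚ} (h1 : 1 ∈ H) {n : ℕ}
    (hn : n ≠ 0) (h : ∀ p k : ℕ, p.Prime → p ^ k ∣ n → ((p ^ k : ℕ) : ℚ)⁻¹ ∈ H) :
    (n : ℚ)⁻¹ ∈ H := by
  induction n using Nat.recOnPosPrimePosCoprime with
  | zero => exact absurd rfl hn
  | one => simpa using h1
  | prime_pow p k hp hk => exact h p k hp dvd_rfl
  | coprime a b ha hb hab iha ihb =>
    exact inv_mul_mem_of_coprime hab (by omega) (by omega)
      (iha (by omega) fun p k hp hd => h p k hp (hd.mul_right b))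
      (ihb (by omega) fun p k hp hd => h p k hp (hd.mul_left a))

theorem AddSubgroup.inv_natCast_mem_of_dvd {H : AddSubgroup ℚ} {m n : ℕ} (hn : n ≠ 0)
    (hmn : m ∣ n) (h : (n : ℚ)⁻¹ ∈ H) : (m : ℚ)⁻¹ ∈ H := by
  obtain ⟨k, rfl⟩ := hmn
  have := intCast_mul_mem h k
  have hk : (k : ℚ) ≠ 0 := mod_cast right_ne_zero_of_mul hn
  have e : ((k : ℤ) : ℚ) * ((m * k : ℕ) : ℚ)⁻¹ = (m : ℚ)⁻¹ := by
    push_cast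
    rw [mul_inv, mul_comm, mul_assoc, inv_mul_cancel₀ hk, mul_one]
  rwa [e] at this

/-- Bézout for numerator and denominator, divided by the denominator. Hence a subgroup containing
`1` is determined by its unit fractions. -/
theorem AddSubgroup.inv_den_mem {H : AddSubgroup ℚ} (h1 : 1 ∈ H) {q : ℚ} (hq : q ∈ H) :
    (q.den : ℚ)⁻¹ ∈ H := by
  have hcop : IsCoprime q.num (q.den : ℤ) := by
    rw [Int.isCoprime_iff_gcd_eq_one, Int.gcd, Int.natAbs_natCast]
    exact q.reduced
  obtain ⟨u, w, huw⟩ := hcop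
  have huw' : (u * q.num + w * q.den : ℚ) = 1 := mod_cast huw
  have hd : (q.den : ℚ) ≠ 0 := by simp
  have : (q.den : ℚ)⁻¹ = u * q + w * 1 := by
    apply mul_right_cancel₀ hd
    rw [inv_mul_cancel₀ hd]
    linear_combination -huw' - u * q.mul_den_eq_num
  rw [this]
  exact H.add_mem (intCast_mul_mem hq u) (intCast_mul_mem h1 w)

end SubgroupsOfRat

/-! ### Primes of `ℤ` and the valuations of `ℚ` -/

namespace IsDedekindDomain.HeightOneSpectrum

open WithZero

theorem exists_natPrime_asIdeal_eq (v : HeightOneSpectrum ℤ) :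
    ∃ p : ℕ, p.Prime ∧ v.asIdeal = Ideal.span {(p : ℤ)} := by
  obtain ⟨g, hg⟩ := (IsPrincipalIdealRing.principal v.asIdeal).principal
  have hg' : v.asIdeal = Ideal.span {g} := hg
  have hg0 : g ≠ 0 := fun h => v.ne_bot (by rw [hg', h, Ideal.span_singleton_eq_bot])
  have hp : Prime g := (Ideal.span_singleton_prime hg0).1 (hg' ▸ v.isPrime)
  exact ⟨g.natAbs, Int.prime_iff_natAbs_prime.1 hp, by rw [Int.span_natAbs, hg']⟩

/-- The prime number that generates a prime ideal of `ℤ`. -/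
noncomputable def natPrime (v : HeightOneSpectrum ℤ) : ℕ := v.exists_natPrime_asIdeal_eq.choose

theorem prime_natPrime (v : HeightOneSpectrum ℤ) : v.natPrime.Prime :=
  v.exists_natPrime_asIdeal_eq.choose_spec.1

theorem asIdeal_eq_span_natPrime (v : HeightOneSpectrum ℤ) :
    v.asIdeal = Ideal.span {(v.natPrime : ℤ)} :=
  v.exists_natPrime_asIdeal_eq.choose_spec.2

theorem exists_natPrime_eq {p : ℕ} (hp : p.Prime) : ∃ v : HeightOneSpectrum ℤ, v.natPrime = p := by
  have hp' : Prime (p : ℤ) := Nat.prime_iff_prime_int.1 hp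
  let v : HeightOneSpectrum ℤ :=
    ⟨Ideal.span {(p : ℤ)}, (Ideal.span_singleton_prime hp'.ne_zero).2 hp', by
      rw [Ne, Ideal.span_singleton_eq_bot]; exact hp'.ne_zero⟩
  have h := v.asIdeal_eq_span_natPrime
  refine ⟨v, ?_⟩
  have h' := Int.natAbs_eq_iff_associated.2 (Ideal.span_singleton_eq_span_singleton.1 h)
  simpa using h'.symm

theorem valuation_intCast_le_exp_iff (v : HeightOneSpectrum ℤ) (n : ℤ) (k : ℕ) :
    v.valuation ℚ n ≤ exp (-(k : ℤ)) ↔ (v.natPrime : ℤ) ^ k ∣ n := by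
  rw [← eq_intCast (algebraMap ℤ ℚ), valuation_of_algebraMap, intValuation_le_pow_iff_mem,
    asIdeal_eq_span_natPrime, Ideal.span_singleton_pow, Ideal.mem_span_singleton]

theorem valuation_intCast_le_one (v : HeightOneSpectrum ℤ) (n : ℤ) : v.valuation ℚ n ≤ 1 := by
  rw [← eq_intCast (algebraMap ℤ ℚ)]
  exact v.valuation_le_one n

theorem valuation_natPrime (v : HeightOneSpectrum ℤ) : v.valuation ℚ v.natPrime = exp (-1 : ℤ) := by
  have h := v.intValuation_singleton (mod_cast v.prime_natPrime.ne_zero)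
    v.asIdeal_eq_span_natPrime
  rw [← h, ← valuation_of_algebraMap (K := ℚ)]
  simp

theorem valuation_natPrime_of_ne {v w : HeightOneSpectrum ℤ} (h : w ≠ v) :
    w.valuation ℚ v.natPrime = 1 := by
  have h1 : w.valuation ℚ (algebraMap ℤ ℚ v.natPrime) = 1 := by
    rw [valuation_eq_one_iff_notMem, asIdeal_eq_span_natPrime, Ideal.mem_span_singleton,
      Int.natCast_dvd_natCast, Nat.prime_dvd_prime_iff_eq w.prime_natPrime v.prime_natPrime]
    intro h2
    apply h
    ext1
    rw [asIdeal_eq_span_natPrime, asIdeal_eq_span_natPrime, h2]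
  simpa using h1

/-- In lowest terms, a prime dividing the denominator leaves the numerator a unit at `v`. For `k =
0` the right side would fail when the prime divides the numerator. -/
theorem pow_natPrime_dvd_den_iff (v : HeightOneSpectrum ℤ) (q : ℚ) {k : ℕ} (hk : k ≠ 0) :
    v.natPrime ^ k ∣ q.den ↔ exp (k : ℤ) ≤ v.valuation ℚ q := by
  have hden : v.valuation ℚ (q.den : ℤ) ≠ 0 := by
    rw [Valuation.ne_zero_iff]; simp
  have hq : v.valuation ℚ q * v.valuation ℚ (q.den : ℤ) = v.valuation ℚ q.num := by
    rw [← map_mul, Int.cast_natCast, q.mul_den_eq_num]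
  rw [← Int.natCast_dvd_natCast, Nat.cast_pow, ← valuation_intCast_le_exp_iff]
  have hexp : exp (k : ℤ) * exp (-(k : ℤ)) = 1 := by rw [← exp_add]; simp
  constructor
  · intro h
    have hnum : v.valuation ℚ q.num = 1 := by
      refine le_antisymm (v.valuation_intCast_le_one _) (not_lt.1 fun hlt => ?_)
      rw [← eq_intCast (algebraMap ℤ ℚ), valuation_lt_one_iff_mem, asIdeal_eq_span_natPrime,
        Ideal.mem_span_singleton, Int.natCast_dvd] at hlt
      rw [valuation_intCast_le_exp_iff] at h
      have h2 : v.natPrime ∣ q.den := by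
        have := (dvd_pow_self (v.natPrime : ℤ) hk).trans h
        exact_mod_cast this
      exact v.prime_natPrime.not_dvd_one (q.reduced ▸ Nat.dvd_gcd hlt h2)
    rw [hnum] at hq
    refine le_of_mul_le_mul_right (?_ : _ ≤ _ * v.valuation ℚ (q.den : ℤ)) (zero_lt_iff.2 hden)
    rw [hq, ← hexp]
    gcongr
  · intro h
    refine le_of_mul_le_mul_left (?_ : exp (k : ℤ) * _ ≤ _) exp_pos
    rw [hexp]
    refine le_trans ?_ (hq.trans_le (v.valuation_intCast_le_one _))
    gcongr

end IsDedekindDomain.HeightOneSpectrum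

/-! ### Finite adeles and the subgroups `H_a` -/

section Adeles

open IsDedekindDomain HeightOneSpectrum WithZero

theorem mem_adeleSubgroup_iff {a : FiniteAdelesRat} {q : ℚ} :
    q ∈ adeleSubgroup a ↔ ∀ v : HeightOneSpectrum ℤ,
      v.valuation ℚ q * Valued.v (a v) ≤ 1 := by
  refine forall_congr' fun v => ?_
  change algebraMap ℚ FiniteAdelesRat q v * a v ∈ _ ↔ _
  rw [mem_adicCompletionIntegers, map_mul, FiniteAdeleRing.algebraMap_apply,
    valuedAdicCompletion_eq_valuation']

/-- Only finitely many components of `a` are non-integral, and a power of the prime clears each of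
them. -/
theorem exists_natCast_mem_adeleSubgroup (a : FiniteAdelesRat) :
    ∃ n : ℕ, n ≠ 0 ∧ (n : ℚ) ∈ adeleSubgroup a := by
  classical
  have hfin : {v : HeightOneSpectrum ℤ | ¬ Valued.v (a v) ≤ 1}.Finite := a.2
  have hloc (v : HeightOneSpectrum ℤ) :
      ∃ k : ℕ, v.valuation ℚ ((v.natPrime : ℚ) ^ k) * Valued.v (a v) ≤ 1 := by
    rcases eq_or_ne (Valued.v (a v)) 0 with h | h
    · exact ⟨0, by rw [h, mul_zero]; exact zero_le⟩
    · refine ⟨(log (Valued.v (a v))).toNat, ?_⟩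
      conv_lhs => rw [← exp_log h]
      rw [map_pow, valuation_natPrime, ← exp_nsmul, ← exp_add, ← exp_zero, exp_le_exp]
      simp
  choose k hk using hloc
  refine ⟨∏ v ∈ hfin.toFinset, v.natPrime ^ k v,
    Finset.prod_ne_zero_iff.2 fun v _ => pow_ne_zero _ v.prime_natPrime.ne_zero,
    mem_adeleSubgroup_iff.2 fun v => ?_⟩
  by_cases hv : v ∈ hfin.toFinset
  · rw [← Finset.mul_prod_erase _ _ hv, Nat.cast_mul, map_mul, mul_right_comm]
    refine mul_le_one' ?_ ?_
    · simpa using hk v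
    · exact_mod_cast v.valuation_intCast_le_one (Nat.cast _)
  · refine mul_le_one' (mod_cast v.valuation_intCast_le_one (Nat.cast _)) ?_
    simpa using hv

theorem adeleSubgroup_ne_bot (a : FiniteAdelesRat) : adeleSubgroup a ≠ ⊥ := fun h => by
  obtain ⟨n, hn, hmem⟩ := exists_natCast_mem_adeleSubgroup a
  rw [h, AddSubgroup.mem_bot] at hmem
  exact hn (mod_cast hmem)

/-- If `a` were larger than `b` at `v`, a rational that is just too large at `v` for `H_a` would
still lie in `H_b`. An integer `n` in `H_b` controls the other places, and a power of the prime at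
`v` adjusts the size there. -/
theorem valued_le_of_adeleSubgroup_le {a b : FiniteAdelesRat}
    (h : adeleSubgroup b ≤ adeleSubgroup a) (v : HeightOneSpectrum ℤ) :
    Valued.v (a v) ≤ Valued.v (b v) := by
  by_contra! hlt
  have ha : Valued.v (a v) ≠ 0 := (zero_le |>.trans_lt hlt).ne'
  obtain ⟨n, hn, hmem⟩ := exists_natCast_mem_adeleSubgroup b
  have hn0 : v.valuation ℚ n ≠ 0 := by rw [Valuation.ne_zero_iff]; exact_mod_cast hn
  -- Chosen so that `q a` has absolute value `exp 1` at `v`, the least value above `1`; as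
  -- logarithms are integers, `q b` is then still integral at `v`.
  let k : ℤ := log (v.valuation ℚ n) + log (Valued.v (a v)) - 1
  let q : ℚ := n * (v.natPrime : ℚ) ^ k
  have hvq : v.valuation ℚ q = exp (1 - log (Valued.v (a v))) := by
    simp only [q]
    rw [map_mul, map_zpow₀, valuation_natPrime, ← exp_zsmul]
    conv_lhs => rw [← exp_log hn0]
    rw [← exp_add]
    congr 1
    simp [k]
    ring
  have hq : q ∈ adeleSubgroup b := by
    rw [mem_adeleSubgroup_iff] at hmem ⊢
    intro w
    rcases eq_or_ne w v with rfl | hw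
    · rw [hvq]
      rcases eq_or_ne (Valued.v (b w)) 0 with hb | hb
      · rw [hb, mul_zero]; exact zero_le
      · rw [← log_lt_log hb ha] at hlt
        conv_lhs => rw [← exp_log hb]
        rw [← exp_add, ← exp_zero, exp_le_exp]
        omega
    · simp only [q]
      rw [map_mul, map_zpow₀, valuation_natPrime_of_ne hw, one_zpow, mul_one]
      exact hmem w
  have := mem_adeleSubgroup_iff.1 (h hq) v
  rw [hvq] at this
  conv_lhs at this => rw [← exp_log ha]
  rw [log_exp, ← exp_add, ← exp_zero, exp_le_exp] at this
  omega

theorem valued_ZHat_unit (u : ZHatˣ) (v : HeightOneSpectrum ℤ) :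
    Valued.v (((u : ZHat) : FiniteAdelesRat) v) = 1 := by
  have h1 : Valued.v (((u : ZHat) : FiniteAdelesRat) v) ≤ 1 := (u : ZHat).2 v
  have h2 : Valued.v ((((u⁻¹ : ZHatˣ) : ZHat) : FiniteAdelesRat) v) ≤ 1 :=
    ((u⁻¹ : ZHatˣ) : ZHat).2 v
  have h3 : ((u : ZHat) : FiniteAdelesRat) v * (((u⁻¹ : ZHatˣ) : ZHat) : FiniteAdelesRat) v = 1 :=
    congrArg (fun t : ZHat => (t : FiniteAdelesRat) v) u.mul_inv
  have h4 := congrArg Valued.v h3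
  rw [map_mul, map_one] at h4
  refine le_antisymm h1 (h4.symm.trans_le ?_)
  exact mul_le_of_le_one_right' h2

/-- Finite adeles with the same absolute values differ by a unit of `ZHat`. -/
theorem exists_ZHat_unit {a b : FiniteAdelesRat}
    (h : ∀ v : HeightOneSpectrum ℤ, Valued.v (a v) = Valued.v (b v)) :
    ∃ u : ZHatˣ, b = a * (u : ZHat) := by
  classical
  let mk (f : ∀ v : HeightOneSpectrum ℤ, v.adicCompletion ℚ) (hf : ∀ v, Valued.v (f v) = 1) :
      ZHat := ⟨⟨f, Filter.Eventually.of_forall fun v => (hf v).le⟩, fun v => (hf v).le⟩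
  -- Where `a v = 0`, also `b v = 0`, and any unit serves.
  let f (v : HeightOneSpectrum ℤ) : v.adicCompletion ℚ := if a v = 0 then 1 else b v / a v
  have hf v : Valued.v (f v) = 1 := by
    simp only [f]
    split_ifs with ha
    · exact map_one _
    · rw [map_div₀, h, div_self]
      rw [← h]
      exact (Valuation.ne_zero_iff _).2 ha
  have hf0 v : f v ≠ 0 := by
    rw [← Valuation.ne_zero_iff Valued.v, hf]
    exact one_ne_zero
  let u : ZHatˣ :=
    { val := mk f hf
      inv := mk (fun v => (f v)⁻¹) fun v => by rw [map_inv₀, hf, inv_one]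
      val_inv := Subtype.ext (FiniteAdeleRing.ext _ fun v => mul_inv_cancel₀ (hf0 v))
      inv_val := Subtype.ext (FiniteAdeleRing.ext _ fun v => inv_mul_cancel₀ (hf0 v)) }
  refine ⟨u, FiniteAdeleRing.ext _ fun v => ?_⟩
  change b v = a v * f v
  simp only [f]
  split_ifs with ha
  · have := h v
    rw [ha, map_zero] at this
    rw [ha, zero_mul, (Valuation.zero_iff _).1 this.symm]
  · rw [mul_div_cancel₀ _ ha]

theorem mem_adeleSubgroup_smul_unit {a : FiniteAdelesRat} {q r : ℚ} (u : ZHatˣ) :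
    r ∈ adeleSubgroup (algebraMap ℚ FiniteAdelesRat q * a * (u : ZHat)) ↔
      r * q ∈ adeleSubgroup a := by
  rw [mem_adeleSubgroup_iff, mem_adeleSubgroup_iff]
  refine forall_congr' fun v => ?_
  have : (algebraMap ℚ FiniteAdelesRat q * a * (u : ZHat)) v =
    algebraMap ℚ FiniteAdelesRat q v * a v * ((u : ZHat) : FiniteAdelesRat) v := rfl
  rw [this, map_mul, map_mul, valued_ZHat_unit, mul_one, map_mul, FiniteAdeleRing.algebraMap_apply,
    valuedAdicCompletion_eq_valuation', mul_assoc]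

/-- Scaling `a` by `q` scales `H_a` by `q⁻¹`, and units do not affect it. Conversely, if
multiplication by `c` maps `H_a` onto `H_b`, then `c⁻¹ a` and `b` have the same subgroup, hence the
same absolute values, and differ by a unit. -/
theorem adeleClassSetoid_iff {a b : FiniteAdelesRat} :
    adeleClassSetoid a b ↔ Nonempty (adeleSubgroup a ≃+o adeleSubgroup b) := by
  rw [AddSubgroup.nonempty_orderIso_iff_exists_mul (adeleSubgroup_ne_bot a)]
  constructor
  · rintro ⟨q, u, hq, rfl⟩
    refine ⟨q⁻¹, inv_pos.2 hq, fun r => ?_⟩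
    rw [mem_adeleSubgroup_smul_unit, mul_right_comm, inv_mul_cancel₀ hq.ne', one_mul]
  · rintro ⟨c, hc, h⟩
    let a' := algebraMap ℚ FiniteAdelesRat c⁻¹ * a
    have heq : adeleSubgroup a' = adeleSubgroup b := by
      ext r
      have := mem_adeleSubgroup_smul_unit (a := a) (q := c⁻¹) (r := r) 1
      rw [Units.val_one, Subring.coe_one, mul_one] at this
      rw [this, h, mul_comm r, mul_inv_cancel_left₀ hc.ne']
    obtain ⟨u, hu⟩ := exists_ZHat_unit (a := a') (b := b) fun v =>
      le_antisymm (valued_le_of_adeleSubgroup_le heq.ge v) (valued_le_of_adeleSubgroup_le heq.le v)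
    exact ⟨c⁻¹, u, inv_pos.2 hc, hu⟩

/-- At a prime `p`, take `p ^ m` for the largest `m` with `p ^ (-m)` in `H`, or `0` if there is no
largest. All components are integral since `1 ∈ H`. Membership in `H` is then tested on the prime
powers dividing the denominator. -/
theorem exists_adeleSubgroup_eq {H : AddSubgroup ℚ} (h1 : 1 ∈ H) :
    ∃ a : FiniteAdelesRat, adeleSubgroup a = H := by
  classical
  have hloc (v : HeightOneSpectrum ℤ) : ∃ x : v.adicCompletion ℚ, Valued.v x ≤ 1 ∧
      ∀ k : ℕ, k ≠ 0 → (((v.natPrime ^ k : ℕ) : ℚ)⁻¹ ∈ H ↔ exp (k : ℤ) * Valued.v x ≤ 1) := by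
    by_cases h : ∃ k : ℕ, ((v.natPrime ^ (k + 1) : ℕ) : ℚ)⁻¹ ∉ H
    -- `Nat.find h` is that largest exponent: the condition is indexed by `k + 1`, so it first fails
    -- just after it.
    · obtain ⟨x, hx⟩ : ∃ x : v.adicCompletion ℚ, Valued.v x = exp (-(Nat.find h : ℤ)) := by
        refine ⟨_, (valuedAdicCompletion_eq_valuation' v ((v.natPrime : ℚ) ^ Nat.find h)).trans ?_⟩
        rw [map_pow, valuation_natPrime, ← exp_nsmul]
        simp
      refine ⟨x, ?_, fun k hk => ?_⟩
      · rw [hx, ← exp_zero, exp_le_exp]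
        omega
      · rw [hx, ← exp_add, ← exp_zero, exp_le_exp]
        constructor
        · intro hmem
          by_contra hlt
          refine Nat.find_spec h (AddSubgroup.inv_natCast_mem_of_dvd
            (pow_ne_zero k v.prime_natPrime.ne_zero) (pow_dvd_pow _ ?_) hmem)
          omega
        · intro hle
          have := Nat.find_min h (m := k - 1) (by omega)
          rwa [not_not, Nat.sub_add_cancel (by omega)] at this
    · push Not at h
      refine ⟨0, by simp, fun k hk => ⟨fun _ => by simp, fun _ => ?_⟩⟩
      have := h (k - 1)
      rwa [Nat.sub_add_cancel (by omega)] at this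
  choose x hx1 hx using hloc
  refine ⟨⟨x, Filter.Eventually.of_forall hx1⟩, ?_⟩
  ext q
  refine mem_adeleSubgroup_iff.trans ?_
  change (∀ v, v.valuation ℚ q * Valued.v (x v) ≤ 1) ↔ _
  constructor
  · intro h
    rw [← q.num_div_den, div_eq_mul_inv]
    refine AddSubgroup.intCast_mul_mem (AddSubgroup.inv_natCast_mem_of_prime_pow h1 q.den_ne_zero
      fun p k hp hd => ?_) q.num
    rcases eq_or_ne k 0 with rfl | hk
    · simpa using h1
    obtain ⟨v, rfl⟩ := exists_natPrime_eq hp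
    rw [hx v k hk]
    refine le_trans ?_ (h v)
    gcongr
    exact (v.pow_natPrime_dvd_den_iff q hk).1 hd
  · intro hq v
    rcases le_or_gt (v.valuation ℚ q) 1 with hle | hgt
    · exact mul_le_one' hle (hx1 v)
    have h0 : v.valuation ℚ q ≠ 0 := (zero_lt_one.trans hgt).ne'
    have hlog : 0 < log (v.valuation ℚ q) := by
      rwa [← log_one, log_lt_log one_ne_zero h0]
    have hk : ((log (v.valuation ℚ q)).toNat : ℤ) = log (v.valuation ℚ q) :=
      Int.toNat_of_nonneg hlog.le
    have hk0 : (log (v.valuation ℚ q)).toNat ≠ 0 := by omega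
    have hd := (v.pow_natPrime_dvd_den_iff q hk0).2 (by rw [hk, exp_log h0])
    have := (hx v _ hk0).1 (AddSubgroup.inv_natCast_mem_of_dvd q.den_ne_zero hd
      (AddSubgroup.inv_den_mem h1 hq))
    rwa [hk, exp_log h0] at this

end Adeles

/-! ### Isomorphism classes of points and adele classes -/

theorem RankOneOrderedGroup.exists_orderIso_adeleSubgroup (G : RankOneOrderedGroup) :
    ∃ a : FiniteAdelesRat, Nonempty (G.carrier ≃+o adeleSubgroup a) := by
  obtain ⟨H, hH, ⟨e⟩⟩ := G.exists_iso
  obtain ⟨K, hK, ⟨f⟩⟩ := AddSubgroup.exists_orderIso_one_mem hH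
  obtain ⟨a, rfl⟩ := exists_adeleSubgroup_eq hK
  exact ⟨a, ⟨e.trans f⟩⟩

theorem RankOneOrderedGroup.nonempty_iso_iff {G G' : RankOneOrderedGroup} :
    Nonempty (G ≅ G') ↔ Nonempty (G.carrier ≃+o G'.carrier) := by
  constructor
  · rintro ⟨i⟩
    have h1 x : i.inv.hom (i.hom.hom x) = x := congrArg (fun f : Hom G G => f.hom x) i.hom_inv_id
    have h2 x : i.hom.hom (i.inv.hom x) = x := congrArg (fun f : Hom G' G' => f.hom x) i.inv_hom_id
    exact ⟨{
      toFun := i.hom.hom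
      invFun := i.inv.hom
      left_inv := h1
      right_inv := h2
      map_add' := map_add i.hom.hom
      map_le_map_iff' := fun {x y} => ⟨fun h => by
        have := i.inv.hom.monotone' h
        change i.inv.hom (i.hom.hom x) ≤ i.inv.hom (i.hom.hom y) at this
        rwa [h1, h1] at this, fun h => i.hom.hom.monotone' h⟩ }⟩
  · rintro ⟨e⟩
    exact ⟨{
      hom := ⟨(e : G.carrier →+o G'.carrier), EquivLike.injective e⟩
      inv := ⟨(e.symm : G'.carrier →+o G.carrier), EquivLike.injective e.symm⟩
      hom_inv_id := Hom.ext (DFunLike.ext _ _ e.symm_apply_apply)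
      inv_hom_id := Hom.ext (DFunLike.ext _ _ e.apply_symm_apply) }⟩

theorem exists_quotient_equiv {C : Type*} [Category C] (E : C ≌ RankOneOrderedGroup) :
    ∃ e : Quotient (isIsomorphicSetoid C) ≃ AdeleDoubleQuotient,
      ∀ (p : C) (a : FiniteAdelesRat),
        e (Quotient.mk _ p) = Quotient.mk adeleClassSetoid a ↔
          Nonempty ((E.functor.obj p).carrier ≃+o adeleSubgroup a) := by
  choose α hα using fun p => (E.functor.obj p).exists_orderIso_adeleSubgroup
  have key (p q : C) : (isIsomorphicSetoid C) p q ↔ adeleClassSetoid (α p) (α q) := by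
    obtain ⟨e⟩ := hα p
    obtain ⟨f⟩ := hα q
    rw [adeleClassSetoid_iff]
    have h1 : (isIsomorphicSetoid C) p q ↔ Nonempty (E.functor.obj p ≅ E.functor.obj q) :=
      ⟨fun ⟨i⟩ => ⟨E.functor.mapIso i⟩, fun ⟨i⟩ => ⟨E.functor.preimageIso i⟩⟩
    rw [h1, RankOneOrderedGroup.nonempty_iso_iff]
    exact ⟨fun ⟨g⟩ => ⟨(e.symm.trans g).trans f⟩, fun ⟨g⟩ => ⟨(e.trans g).trans f.symm⟩⟩
  let m : Quotient (isIsomorphicSetoid C) → AdeleDoubleQuotient :=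
    Quotient.map α fun p q h => (key p q).1 h
  have hm (p : C) (a : FiniteAdelesRat) :
      m (Quotient.mk _ p) = Quotient.mk adeleClassSetoid a ↔
        Nonempty ((E.functor.obj p).carrier ≃+o adeleSubgroup a) := by
    obtain ⟨e⟩ := hα p
    refine (Quotient.eq (r := adeleClassSetoid)).trans (adeleClassSetoid_iff.trans ?_)
    exact ⟨fun ⟨g⟩ => ⟨e.trans g⟩, fun ⟨g⟩ => ⟨e.symm.trans g⟩⟩
  refine ⟨Equiv.ofBijective m ⟨?_, ?_⟩, hm⟩
  · rintro ⟨p⟩ ⟨q⟩ h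
    exact Quotient.sound ((key p q).2 (Quotient.exact h))
  · rintro ⟨a⟩
    let G := RankOneOrderedGroup.ofSubgroup (adeleSubgroup a) (adeleSubgroup_ne_bot a)
    refine ⟨Quotient.mk _ (E.inverse.obj G), (hm _ a).2 ?_⟩
    exact RankOneOrderedGroup.nonempty_iso_iff.1 ⟨E.counitIso.app G⟩

theorem theorem1 :
    ∃ E : ToposPoint NTimesTopos ≌ RankOneOrderedGroup,
      Nonempty (E.functor ⋙ RankOneOrderedGroup.positivePart ≅ fiberFunctor) ∧
      ∃ e : Quotient (isIsomorphicSetoid (ToposPoint NTimesTopos)) ≃ AdeleDoubleQuotient,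
        ∀ (p : ToposPoint NTimesTopos) (a : FiniteAdelesRat),
          e (Quotient.mk _ p) = Quotient.mk adeleClassSetoid a ↔
            Nonempty ((E.functor.obj p).carrier ≃+o adeleSubgroup a) := by
  obtain ⟨E, hE⟩ := exists_toposPoint_equivalence
  exact ⟨E, hE, exists_quotient_equiv E⟩
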